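/- Let $\pi,\delta,\rho>0$ (death rate, private discount rate, social discount rate), let $f:(0,\infty)\to\mathbb R$ be a concave, twice continuously differentiable production function, let $$h(t)=\frac{\delta-\rho}{\pi+\delta-\rho}e^{-(\delta+\pi)t}+\frac{\pi}{\pi+\delta-\rho}e^{-\rho t}, \qquad I=\Big\{k>0 : \rho\,\frac{\pi+\delta}{\pi+\rho}<f'(k)<\delta\Big\},$$ and assume $f>0$ on $I$. In the overlapping-generations model the government at date $t$ has the objective $\int_t^\infty h(s-t)\ln C(s)\,ds$ over aggregate consumption paths, subject to $k'(s)=f(k(s))-C(s)$. A strategy is a continuously differentiable function $\sigma:\Omega\to(0,\infty)$ on an open set $\Omega\subseteq(0,\infty)$. It converges to $\bar k$ if for every $k_0$ sufficiently close to $\bar k$ the solution of $k'=f(k)-\sigma(k)$, $k(0)=k_0$, exists in $\Omega$ for all $t\ge 0$ and tends to $\bar k$ as $t\to\infty$. A strategy converging to some point is an equilibrium strategy if for every $k\in\Omega$ the solution $k_0(t)$ of $k_0'=f(k_0)-\sigma(k_0)$, $k_0(0)=k$, exists in $\Omega$ for all $t\ge0$, the integral $\int_0^\infty h(t)\ln\sigma(k_0(t))\,dt$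 converges absolutely, and $c=\sigma(k)$ is the unique maximizer over $c>0$ of $$P_1(k,\sigma,c)=\ln c-\ln\sigma(k)+\int_0^\infty h(t)\,\frac{\sigma'(k_0(t))}{\sigma(k_0(t))}\,k_1(t)\,dt ,$$ where $k_1'=\big(f'(k_0)-\sigma'(k_0)\big)k_1$, $k_1(0)=\sigma(k)-c$, and this integral is absolutely convergent for every $c>0$. Then for every $\bar k\in I$ there is an equilibrium strategy which is defined on a neighbourhood $\Omega$ of $\bar k$ and converges to $\bar k$. Hence, if $I\neq\emptyset$, there is a continuum of equilibrium steady states: the set of points $\bar k$ to which an equilibrium strategy defined on a neighbourhood of $\bar k$ converges contains a nondegenerate open interval and has the cardinality of the continuum. -/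

import Mathlib

open Set Filter Topology MeasureTheory

namespace GrowthGame

/-- `κ` is the capital path starting at `k`, staying in the domain `Ω` of the Markov strategy `σ`,
and generated by applying `σ` at all dates `t ≥ 0`:
`κ' = f κ - σ κ`, `κ 0 = k`. -/
structure IsCapitalPath (f : ℝ → ℝ) (Ω : Set ℝ) (σ : ℝ → ℝ) (k : ℝ) (κ : ℝ → ℝ) : Prop where
  init : κ 0 = k
  mem : ∀ t, 0 ≤ t → κ t ∈ Ω
  ode : ∀ t, 0 ≤ t → HasDerivWithinAt κ (f (κ t) - σ (κ t)) (Ici 0) t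

/-- The strategy `σ`, defined on `Ω`, converges to the steady state `kbar`: for every initial
capital stock sufficiently close to `kbar`, the capital path generated by `σ` exists for all
`t ≥ 0` and tends to `kbar`. -/
def ConvergesTo (f : ℝ → ℝ) (Ω : Set ℝ) (σ : ℝ → ℝ) (kbar : ℝ) : Prop :=
  ∀ᶠ k₀ in 𝓝 kbar, ∃ κ : ℝ → ℝ, IsCapitalPath f Ω σ k₀ κ ∧ Tendsto κ atTop (𝓝 kbar)

/-- `k₁` solves the equation of `IsCapitalPath` linearized along the path `κ`:
`k₁' = (f' κ - σ' κ) k₁`, `k₁ 0 = y`. -/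
structure IsVariation (f σ κ : ℝ → ℝ) (y : ℝ) (k₁ : ℝ → ℝ) : Prop where
  init : k₁ 0 = y
  ode : ∀ t, 0 ≤ t →
    HasDerivWithinAt k₁ ((deriv f (κ t) - deriv σ (κ t)) * k₁ t) (Ici 0) t

/-- The integrand `h u'(σ κ) σ'(κ) k₁` of the first-order effect of a deviation. -/
noncomputable def variationIntegrand (h u σ κ k₁ : ℝ → ℝ) (t : ℝ) : ℝ :=
  h t * deriv u (σ (κ t)) * deriv σ (κ t) * k₁ t

/-- The coefficient `P₁(k, σ, c)` of `ε` in the payoff of a decision maker who consumes `c`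
during `[0, ε]`, all later decision makers applying `σ`. Here `κ` is the capital path from `k`,
and `k₁` is the variation along `κ` with initial value `σ k - c`. -/
noncomputable def firstOrderGain (h u σ : ℝ → ℝ) (k : ℝ) (κ k₁ : ℝ → ℝ) (c : ℝ) : ℝ :=
  u c - u (σ k) + ∫ t in Ioi (0 : ℝ), variationIntegrand h u σ κ k₁ t

/-- No commitment at capital stock `k`: among all consumption rates `c > 0`, the first-order gain
`c ↦ P₁(k, σ, c)` has its maximum at `c = σ k` and only there. The capital path from `k`, the
objective along it, and the quantities entering `P₁` are required to exist. -/
def IsOptimalAt (f h u : ℝ → ℝ) (Ω : Set ℝ) (σ : ℝ → ℝ) (k : ℝ) : Prop :=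
  ∃ κ : ℝ → ℝ, IsCapitalPath f Ω σ k κ ∧
    IntegrableOn (fun t => h t * u (σ (κ t))) (Ioi 0) ∧
    ∃ k₁ : ℝ → ℝ → ℝ,
      (∀ c, 0 < c → IsVariation f σ κ (σ k - c) (k₁ c)) ∧
      (∀ c, 0 < c → IntegrableOn (variationIntegrand h u σ κ (k₁ c)) (Ioi 0)) ∧
      ∀ c, 0 < c → c ≠ σ k →
        firstOrderGain h u σ k κ (k₁ c) c < firstOrderGain h u σ k κ (k₁ (σ k)) (σ k)

/-- `σ`, defined on the open set `Ω` of positive capital stocks, is an equilibrium strategy for the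
objective `∫ h(s - t) u(c(s)) ds` under the constraint `k' = f k - c`: it is a continuously
differentiable convergent Markov strategy with positive consumption, and at every capital stock in
`Ω` the decision maker's optimal choice is to apply `σ`. -/
structure IsEquilibriumStrategy (f h u : ℝ → ℝ) (Ω : Set ℝ) (σ : ℝ → ℝ) : Prop where
  isOpen : IsOpen Ω
  capital_pos : Ω ⊆ Ioi 0
  consumption_pos : ∀ k ∈ Ω, 0 < σ k
  contDiff : ContDiffOn ℝ 1 σ Ω
  convergent : ∃ kbar, ConvergesTo f Ω σ kbar
  optimal : ∀ k ∈ Ω, IsOptimalAt f h u Ω σ k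

/-- The discount function of the government in the overlapping-generations economy with death
rate `π`, private discount rate `δ` and social discount rate `ρ`. -/
noncomputable def olgDiscount (π δ ρ : ℝ) (t : ℝ) : ℝ :=
  (δ - ρ) / (π + δ - ρ) * Real.exp (-(δ + π) * t) + π / (π + δ - ρ) * Real.exp (-ρ * t)

/-- The set `I` of capital stocks `k` with `ρ (π + δ) / (π + ρ) < f' k < δ`. -/
def olgRange (f : ℝ → ℝ) (π δ ρ : ℝ) : Set ℝ :=
  {k | 0 < k ∧ ρ * ((π + δ) / (π + ρ)) < deriv f k ∧ deriv f k < δ}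

/-- The steady states of the overlapping-generations economy to which some equilibrium strategy,
defined on a neighbourhood, converges. -/
def olgSteadyStates (f : ℝ → ℝ) (π δ ρ : ℝ) : Set ℝ :=
  {kbar | ∃ (Ω : Set ℝ) (σ : ℝ → ℝ), Ω ∈ 𝓝 kbar ∧
    IsEquilibriumStrategy f (olgDiscount π δ ρ) Real.log Ω σ ∧ ConvergesTo f Ω σ kbar}

end GrowthGame

/-!
# A continuum of equilibrium steady states in the overlapping-generations growth model

Write `F k = f k - σ k` for net investment. Since `log` is strictly concave and the first-order
gain is affine in `c` up to `log c`, a strategy is optimal at `k` as soon as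
`∫ h(t) (σ'/σ)(κ t) N(t) dt = 1 / σ k`, where `N` solves the linearized equation with `N 0 = 1`.
The discount function is a combination of two exponentials, with weight `b = π / (π + δ - ρ)` on
`exp (-ρ t)`. Call `p` the derivative in `k` of `∫ exp (-ρ t) log σ(κ t) dt`. The equilibrium
condition then follows from the pair
`F p' = ρ p - σ'/σ - p (f' - σ')` and `π p σ = π + δ - f' + σ' F / σ`,
because under this pair the integrand has an explicit antiderivative
(`isOptimalAt_of_multiplier`).

Eliminating `p` gives an equation for `g = σ'`, namely `F² g' = slowNumerator`, which is singular at
`kbar`. At `kbar` itself it forces `g = s` with `s (δ - f') = (f' - ρ)(π + δ - f')`. Stability of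
`kbar`, that is `f' - s < 0`, is exactly the lower bound in the definition of `olgRange`, and the
upper bound makes the linear part of the equation nondegenerate.

With `x = k - kbar`, `F = x φ` and `u = -1 / x`, the equation becomes
`dg/du = A (g - s) + E` on both sides of `kbar`, where `φ` is an average of `f' - g` and `E` is
small and has a small Lipschitz constant near the singular point, by the choice of `A`
(`exists_slowRemainder_lipschitz`). Its bounded solutions are the fixed points of
`g ↦ s - ∫₀^∞ exp (-A r) E(u + r) dr`, a contraction on bounded continuous functions
(`exists_slow_solution`). On the side `x > 0` the shift `u + r` is stopped when `x` reaches the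
boundary `ε` of the domain; both sides are treated at once by the map `slide`.

The strategy is the primitive of the fixed point with `σ kbar = f kbar`. Since `F = x φ` with `φ`
negative, capital paths are `kbar + x₀ exp (-z t)` with `z' = -φ`, which a change of time provides
(`exists_decaying_path`). As `olgRange` is open, a nonempty one contains an interval, hence a
continuum of steady states.
-/

namespace GrowthGame

/-! ### Integrals against a decaying exponential -/

theorem integrableOn_exp_mul_of_bounded {A M : ℝ} (hA : 0 < A) {E : ℝ → ℝ}
    (hE : ContinuousOn E (Ioi 0)) (hM : ∀ r ∈ Ioi (0 : ℝ), |E r| ≤ M) :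
    IntegrableOn (fun r => Real.exp (-A * r) * E r) (Ioi 0) := by
  refine Integrable.mono' ((exp_neg_integrableOn_Ioi 0 hA).mul_const M) ?_ ?_
  · refine ContinuousOn.aestronglyMeasurable ?_ measurableSet_Ioi
    exact (by fun_prop : Continuous fun r : ℝ => Real.exp (-A * r)).continuousOn.mul hE
  · refine (ae_restrict_iff' measurableSet_Ioi).2 (Eventually.of_forall fun r hr => ?_)
    rw [Real.norm_eq_abs, abs_mul, abs_of_pos (Real.exp_pos _)]
    exact mul_le_mul_of_nonneg_left (hM r hr) (Real.exp_pos _).le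

theorem integral_exp_neg_mul_Ioi_zero {A : ℝ} (hA : 0 < A) :
    ∫ r in Ioi (0 : ℝ), Real.exp (-A * r) = 1 / A := by
  have := integral_exp_mul_Ioi (a := -A) (by linarith) 0
  rw [this]
  simp

theorem abs_integral_exp_mul_le {A M : ℝ} (hA : 0 < A) {E : ℝ → ℝ}
    (hM : ∀ r ∈ Ioi (0 : ℝ), |E r| ≤ M) :
    |∫ r in Ioi (0 : ℝ), Real.exp (-A * r) * E r| ≤ M / A := by
  have h := norm_integral_le_of_norm_le (μ := volume.restrict (Ioi (0 : ℝ)))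
    (f := fun r => Real.exp (-A * r) * E r)
    ((exp_neg_integrableOn_Ioi 0 hA).mul_const M) ?_
  · rw [integral_mul_const, integral_exp_neg_mul_Ioi_zero hA] at h
    calc _ ≤ 1 / A * M := h
      _ = M / A := by ring
  · refine (ae_restrict_iff' measurableSet_Ioi).2 (Eventually.of_forall fun r hr => ?_)
    rw [Real.norm_eq_abs, abs_mul, abs_of_pos (Real.exp_pos _)]
    exact mul_le_mul_of_nonneg_left (hM r hr) (Real.exp_pos _).le

/-- The resolvent integral solves `ψ' = A ψ - E`; it is the only bounded solution. -/
theorem hasDerivAt_integral_exp_mul_shift {A M : ℝ} (hA : 0 < A) {E : ℝ → ℝ}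
    (hE : Continuous E) (hM : ∀ v, |E v| ≤ M) (u : ℝ) :
    HasDerivAt (fun u => ∫ r in Ioi (0 : ℝ), Real.exp (-A * r) * E (u + r))
      (A * (∫ r in Ioi (0 : ℝ), Real.exp (-A * r) * E (u + r)) - E u) u := by
  have hint : IntegrableOn (fun v => Real.exp (-A * v) * E v) (Ioi 0) :=
    integrableOn_exp_mul_of_bounded hA hE.continuousOn fun v _ => hM v
  have hcont : Continuous fun v => Real.exp (-A * v) * E v := by fun_prop
  have key : ∀ u, ∫ r in Ioi (0 : ℝ), Real.exp (-A * r) * E (u + r) =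
      Real.exp (A * u) * ((∫ v in Ioi (0 : ℝ), Real.exp (-A * v) * E v) -
        ∫ v in (0 : ℝ)..u, Real.exp (-A * v) * E v) := by
    intro u
    have hu : IntegrableOn (fun v => Real.exp (-A * v) * E v) (Ioi u) := by
      rcases le_total 0 u with h | h
      · exact hint.mono_set (Ioi_subset_Ioi h)
      · rw [← Ioc_union_Ioi_eq_Ioi h]
        exact (hcont.integrableOn_Ioc).union hint
    rw [← intervalIntegral.integral_Ioi_sub_Ioi' hint hu, sub_sub_cancel]
    rw [← integral_const_mul]
    have h2 := (measurePreserving_add_left (volume : Measure ℝ) u).setIntegral_preimage_emb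
      (MeasurableEquiv.addLeft u).measurableEmbedding
      (fun v => Real.exp (A * u) * (Real.exp (-A * v) * E v)) (Ioi u)
    rw [← h2]
    have h3 : (u + ·) ⁻¹' Ioi u = Ioi (0 : ℝ) := by ext; simp
    rw [h3]
    congr 1
    ext r
    rw [← mul_assoc, ← Real.exp_add]
    congr 2
    ring
  have hd : HasDerivAt (fun u => Real.exp (A * u) *
      ((∫ v in Ioi (0 : ℝ), Real.exp (-A * v) * E v) -
        ∫ v in (0 : ℝ)..u, Real.exp (-A * v) * E v))
      ((Real.exp (A * u) * (A * 1)) * ((∫ v in Ioi (0 : ℝ), Real.exp (-A * v) * E v) -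
        ∫ v in (0 : ℝ)..u, Real.exp (-A * v) * E v) +
        Real.exp (A * u) * (0 - Real.exp (-A * u) * E u)) u := by
    refine HasDerivAt.mul ((hasDerivAt_id u).const_mul A).exp ?_
    refine (hasDerivAt_const _ _).sub ?_
    exact intervalIntegral.integral_hasDerivAt_right (hcont.intervalIntegrable _ _)
      (hcont.stronglyMeasurableAtFilter _ _) hcont.continuousAt
  rw [key u, funext key]
  convert hd using 1
  have : Real.exp (A * u) * Real.exp (-A * u) = 1 := by
    rw [← Real.exp_add]; simp
  linear_combination E u * this

/-! ### The singular equation as a fixed point problem -/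

/-- The image of `x` under the shift `u ↦ u + r` in the coordinate `u = -1 / x`, stopped at `ε` when
`0 < x ≤ ε`. For `r ≥ 0` the denominator is positive for every real `x`, so that the map is
continuous across `x = 0`, which it fixes. -/
noncomputable def slide (ε x r : ℝ) : ℝ := x / max (1 - r * x) (x / ε)

theorem slide_denom_pos {ε : ℝ} (hε : 0 < ε) (x : ℝ) {r : ℝ} (hr : 0 ≤ r) :
    0 < max (1 - r * x) (x / ε) := by
  rcases lt_or_ge 0 x with h | h
  · exact lt_max_of_lt_right (by positivity)
  · exact lt_max_of_lt_left (by nlinarith)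

theorem slide_zero (ε r : ℝ) : slide ε 0 r = 0 := by simp [slide]

theorem slide_eq_of_pos {ε x r : ℝ} (hε : 0 < ε) (hx : 0 < x) (hr : 0 ≤ r) :
    slide ε x r = -1 / min (-1 / x + r) (-1 / ε) := by
  have h : max (1 - r * x) (x / ε) = -x * min (-1 / x + r) (-1 / ε) := by
    have ha : -x * (-1 / x + r) = 1 - r * x := by field_simp; ring
    have hb : -x * (-1 / ε) = x / ε := by ring
    rw [← ha, ← hb]
    exact ((show Antitone fun y => -x * y from fun y z hyz =>
      mul_le_mul_of_nonpos_left hyz (by linarith)).map_min (a := -1 / x + r) (b := -1 / ε)).symm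
  have hp := slide_denom_pos hε x hr
  rw [slide, h]
  rw [h] at hp
  have : min (-1 / x + r) (-1 / ε) ≠ 0 := by
    intro h0; rw [h0] at hp; simp at hp
  field_simp

theorem slide_eq_of_neg {ε x r : ℝ} (hε : 0 < ε) (hx : x < 0) (hx' : -ε < x) (hr : 0 ≤ r) :
    slide ε x r = -1 / max (-1 / x + r) (1 / ε) := by
  have h1 : max (1 - r * x) (x / ε) = 1 - r * x := by
    refine max_eq_left ?_
    have : x / ε < 0 := div_neg_of_neg_of_pos hx hε
    nlinarith
  have h2 : max (-1 / x + r) (1 / ε) = -1 / x + r := by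
    refine max_eq_left ?_
    have : 1 / ε ≤ 1 / (-x) := one_div_le_one_div_of_le (by linarith) (by linarith)
    rw [one_div_neg_eq_neg_one_div] at this
    have h3 : -1 / x = -(1 / x) := by ring
    linarith
  have h3 : 0 < 1 - r * x := by nlinarith
  have h4 : -1 / x + r = (1 - r * x) / (-x) := by
    rw [div_neg, sub_div, mul_div_cancel_right₀ _ hx.ne]; ring
  rw [slide, h1, h2, h4]
  field_simp

theorem continuous_slide {ε : ℝ} (hε : 0 < ε) {r : ℝ} (hr : 0 ≤ r) :
    Continuous fun x => slide ε x r := by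
  unfold slide
  exact continuous_id.div (by fun_prop) fun x => (slide_denom_pos hε x hr).ne'

theorem continuousOn_slide {ε : ℝ} (hε : 0 < ε) (x : ℝ) :
    ContinuousOn (fun r => slide ε x r) (Ioi 0) := by
  unfold slide
  refine continuousOn_const.div (by fun_prop) fun r hr => (slide_denom_pos hε x (le_of_lt hr)).ne'

theorem continuous_integral_slide {A M ε : ℝ} (hA : 0 < A) (hε : 0 < ε) {E : ℝ → ℝ}
    (hE : Continuous E) (hM : ∀ v, |E v| ≤ M) :
    Continuous fun x => ∫ r in Ioi (0 : ℝ), Real.exp (-A * r) * E (slide ε x r) := by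
  refine continuous_of_dominated (bound := fun r => Real.exp (-A * r) * M) ?_ ?_
    ((exp_neg_integrableOn_Ioi 0 hA).mul_const M) ?_
  · intro x
    refine ContinuousOn.aestronglyMeasurable ?_ measurableSet_Ioi
    exact (by fun_prop : Continuous fun r : ℝ => Real.exp (-A * r)).continuousOn.mul
      (hE.comp_continuousOn (continuousOn_slide hε x))
  · refine fun x => Eventually.of_forall fun r => ?_
    rw [Real.norm_eq_abs, abs_mul, abs_of_pos (Real.exp_pos _)]
    exact mul_le_mul_of_nonneg_left (hM _) (Real.exp_pos _).le
  · refine (ae_restrict_iff' measurableSet_Ioi).2 (Eventually.of_forall fun r hr => ?_)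
    exact continuous_const.mul (hE.comp (continuous_slide hε (le_of_lt hr)))

/-- In the variable `x` the resolvent integral solves an equation with a double zero at `x = 0`. -/
theorem hasDerivAt_integral_slide {A M ε : ℝ} (hA : 0 < A) (hε : 0 < ε) {E : ℝ → ℝ}
    (hE : Continuous E) (hM : ∀ v, |E v| ≤ M) {x : ℝ} (hx0 : x ≠ 0) (hx : |x| < ε) :
    HasDerivAt (fun x => ∫ r in Ioi (0 : ℝ), Real.exp (-A * r) * E (slide ε x r))
      ((A * (∫ r in Ioi (0 : ℝ), Real.exp (-A * r) * E (slide ε x r)) - E x) / x ^ 2) x := by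
  have hinv : HasDerivAt (fun x : ℝ => -1 / x) (1 / x ^ 2) x := by
    have h := (hasDerivAt_inv hx0).neg
    rw [neg_neg] at h
    simpa [neg_div, Pi.neg_def] using h
  obtain ⟨h1, h2⟩ := abs_lt.1 hx
  -- In the coordinate `u = -1 / x`, sliding by `r` is the shift by `r`, read back through `Q`.
  have main : ∀ Q : ℝ → ℝ, Continuous (fun v => E (Q v)) → Q (-1 / x) = x →
      (∀ᶠ y in 𝓝 x, ∀ r ∈ Ioi (0 : ℝ), slide ε y r = Q (-1 / y + r)) →
      HasDerivAt (fun x => ∫ r in Ioi (0 : ℝ), Real.exp (-A * r) * E (slide ε x r))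
      ((A * (∫ r in Ioi (0 : ℝ), Real.exp (-A * r) * E (slide ε x r)) - E x) / x ^ 2) x := by
    intro Q hQ hQx hev
    have hd := (hasDerivAt_integral_exp_mul_shift hA hQ (fun v => hM _) (-1 / x)).comp x hinv
    have heq : ∀ᶠ y in 𝓝 x, ∫ r in Ioi (0 : ℝ), Real.exp (-A * r) * E (slide ε y r) =
        ∫ r in Ioi (0 : ℝ), Real.exp (-A * r) * E (Q (-1 / y + r)) := by
      filter_upwards [hev] with y hy
      exact setIntegral_congr_fun measurableSet_Ioi fun r hr => by simp only [hy r hr]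
    have := hd.congr_of_eventuallyEq heq
    rw [heq.self_of_nhds]
    rwa [hQx, mul_one_div] at this
  rcases lt_or_gt_of_ne hx0 with h | h
  · have hle : 1 / ε ≤ -1 / x := by
      rw [← neg_div_neg_eq (-1) x, neg_neg]
      exact one_div_le_one_div_of_le (by linarith) (by linarith)
    refine main (fun v => -1 / max v (1 / ε)) (hE.comp (continuous_const.div (by fun_prop)
      fun v => (lt_max_of_lt_right (by positivity)).ne')) ?_ ?_
    · simp only [max_eq_left hle]
      field_simp
    · filter_upwards [Ioo_mem_nhds h1 h] with y hy r hr
      exact slide_eq_of_neg hε hy.2 hy.1 (le_of_lt hr)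
  · have hle : -1 / x ≤ -1 / ε := by
      rw [neg_div, neg_div]
      exact neg_le_neg (one_div_le_one_div_of_le h h2.le)
    refine main (fun v => -1 / min v (-1 / ε)) (hE.comp (continuous_const.div (by fun_prop)
      fun v => (min_lt_of_right_lt (div_neg_of_neg_of_pos (by norm_num) hε)).ne)) ?_ ?_
    · simp only [min_eq_left hle]
      field_simp
    · filter_upwards [Ioi_mem_nhds h] with y hy r hr
      exact slide_eq_of_pos hε hy (le_of_lt hr)

/-- `meanSlope f₁ g x` is `∫₀¹ (f₁ - g)(t x) dt`, i.e. `F x / x` for the primitive `F` of `f₁ - g`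
vanishing at `0`; at `x = 0` it is `F' 0`. -/
noncomputable def meanSlope (f₁ g : ℝ → ℝ) (x : ℝ) : ℝ :=
  ∫ t in (0 : ℝ)..1, (f₁ (t * x) - g (t * x))

theorem continuous_meanSlope {f₁ g : ℝ → ℝ} (hf : Continuous f₁) (hg : Continuous g) :
    Continuous (meanSlope f₁ g) := by
  unfold meanSlope
  exact intervalIntegral.continuous_parametric_intervalIntegral_of_continuous' (by fun_prop) 0 1

theorem abs_meanSlope_sub_le {f₁ f₁' g g' : ℝ → ℝ} (hf : Continuous f₁) (hf' : Continuous f₁')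
    (hg : Continuous g) (hg' : Continuous g') {d : ℝ}
    (hd : ∀ y, |(f₁ y - g y) - (f₁' y - g' y)| ≤ d) (x : ℝ) :
    |meanSlope f₁ g x - meanSlope f₁' g' x| ≤ d := by
  unfold meanSlope
  rw [← intervalIntegral.integral_sub (Continuous.intervalIntegrable (by fun_prop) _ _)
    (Continuous.intervalIntegrable (by fun_prop) _ _)]
  simpa using intervalIntegral.norm_integral_le_of_norm_le_const (a := (0 : ℝ)) (b := 1)
    (f := fun t => f₁ (t * x) - g (t * x) - (f₁' (t * x) - g' (t * x)))
    (fun t _ => hd (t * x))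

theorem mul_meanSlope (f₁ g : ℝ → ℝ) (x : ℝ) :
    x * meanSlope f₁ g x = ∫ y in (0 : ℝ)..x, (f₁ y - g y) := by
  have := intervalIntegral.mul_integral_comp_mul_right (a := 0) (b := 1)
    (f := fun y => f₁ y - g y) x
  simpa [meanSlope] using this

open BoundedContinuousFunction in
/-- The singular equation `x² g' = A (g - s) + e(x, φ, g)`, in which `φ` is the average of `f₁ - g`
between `0` and `x`, has a continuous solution with `g 0 = s` on `(-ε, ε)`, if `e` is bounded, has
Lipschitz constant less than `A` in its last two variables, and vanishes at `x = 0`, `g = s`. -/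
theorem exists_slow_solution {A M ε s : ℝ} (hA : 0 < A) (hε : 0 < ε) {f₁ : ℝ → ℝ}
    (hf₁ : Continuous f₁) {e : ℝ → ℝ → ℝ → ℝ}
    (he : Continuous fun q : ℝ × ℝ × ℝ => e q.1 q.2.1 q.2.2)
    (hM : ∀ x φ y, |e x φ y| ≤ M)
    (hlip : ∀ x φ y φ' y', |e x φ y - e x φ' y'| ≤ A / 4 * max |φ - φ'| |y - y'|)
    (h0 : ∀ φ, e 0 φ s = 0) :
    ∃ g : ℝ → ℝ, Continuous g ∧ (∀ x, |g x - s| ≤ M / A) ∧ g 0 = s ∧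
      ∀ x, x ≠ 0 → |x| < ε →
        HasDerivAt g ((A * (g x - s) + e x (meanSlope f₁ g x) (g x)) / x ^ 2) x := by
  set E : (ℝ → ℝ) → ℝ → ℝ := fun g x => e x (meanSlope f₁ g x) (g x) with hE_def
  have hEc : ∀ g : ℝ → ℝ, Continuous g → Continuous (E g) := fun g hg =>
    he.comp (continuous_id.prodMk ((continuous_meanSlope hf₁ hg).prodMk hg))
  have hEM : ∀ (g : ℝ → ℝ) v, |E g v| ≤ M := fun g v => hM _ _ _
  let I : (ℝ → ℝ) → ℝ → ℝ := fun g x => ∫ r in Ioi (0 : ℝ), Real.exp (-A * r) * E g (slide ε x r)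
  have hI : ∀ g x, |I g x| ≤ M / A := fun g x => abs_integral_exp_mul_le hA fun r _ => hEM _ _
  let T : (ℝ →ᵇ ℝ) → (ℝ →ᵇ ℝ) := fun g => BoundedContinuousFunction.ofNormedAddCommGroup
    (fun x => s - I g x)
    (continuous_const.sub (continuous_integral_slide hA hε (hEc g g.continuous) (hEM g)))
    (|s| + M / A) (fun x => (abs_sub _ _).trans (by gcongr; exact hI g x))
  -- The kernel has mass `1 / A`, so the Lipschitz constant `A / 4` of `e` gives the ratio `1 / 4`.
  have hT : ContractingWith (1 / 4) T := by
    refine ⟨by norm_num, LipschitzWith.of_dist_le_mul fun g g' => ?_⟩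
    rw [BoundedContinuousFunction.dist_le (by positivity)]
    intro x
    have hpt : ∀ y, |g y - g' y| ≤ dist g g' := fun y => by
      rw [← Real.dist_eq]; exact BoundedContinuousFunction.dist_coe_le_dist y
    have hEE : ∀ y, |E g y - E g' y| ≤ A / 4 * dist g g' := by
      intro y
      refine (hlip _ _ _ _ _).trans ?_
      gcongr
      refine max_le (abs_meanSlope_sub_le hf₁ hf₁ g.continuous g'.continuous (fun z => ?_) y)
        (hpt y)
      rw [sub_sub_sub_cancel_left, abs_sub_comm]
      exact hpt z
    have hsub : T g x - T g' x = -∫ r in Ioi (0 : ℝ),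
        Real.exp (-A * r) * (E g (slide ε x r) - E g' (slide ε x r)) := by
      have hi : ∀ g : ℝ →ᵇ ℝ, IntegrableOn
          (fun r => Real.exp (-A * r) * E g (slide ε x r)) (Ioi 0) := fun g =>
        integrableOn_exp_mul_of_bounded hA
          ((hEc g g.continuous).comp_continuousOn (continuousOn_slide hε x)) fun r _ => hEM _ _
      simp only [mul_sub]
      rw [integral_sub (hi g) (hi g')]
      change (s - I g x) - (s - I g' x) = -(I g x - I g' x)
      ring
    rw [Real.dist_eq, hsub, abs_neg]
    refine (abs_integral_exp_mul_le hA fun r _ => hEE _).trans (le_of_eq ?_)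
    push_cast
    field_simp
  obtain ⟨g, hg⟩ : ∃ g, T g = g := ⟨_, hT.fixedPoint_isFixedPt⟩
  have hgx : ∀ x, g x = s - I g x := fun x => by
    conv_lhs => rw [← hg]
    rfl
  refine ⟨g, g.continuous, fun x => ?_, ?_, fun x hx0 hx => ?_⟩
  · rw [hgx x, sub_sub_cancel_left, abs_neg]
    exact hI g x
  · have h1 : I g 0 = 1 / A * E g 0 := by
      simp only [I, slide_zero]
      rw [integral_mul_const, integral_exp_neg_mul_Ioi_zero hA]
    have h2 : |E g 0| ≤ A / 4 * |g 0 - s| := by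
      have := hlip 0 (meanSlope f₁ g 0) (g 0) (meanSlope f₁ g 0) s
      rw [h0, sub_self, abs_zero, sub_zero, max_eq_right (abs_nonneg _)] at this
      exact this
    have h3 := hgx 0
    rw [h1] at h3
    have h4 : |g 0 - s| ≤ 1 / 4 * |g 0 - s| := by
      calc |g 0 - s| = 1 / A * |E g 0| := by
            rw [h3, sub_sub_cancel_left, abs_neg, abs_mul, abs_of_pos (by positivity : 0 < 1 / A)]
        _ ≤ 1 / A * (A / 4 * |g 0 - s|) := by gcongr
        _ = _ := by field_simp
    have h5 : |g 0 - s| = 0 := by linarith [abs_nonneg (g 0 - s)]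
    linarith [abs_eq_zero.1 h5]
  · have hd := (hasDerivAt_integral_slide hA hε (hEc g g.continuous) (hEM g) hx0 hx).const_sub s
    have hfun : (g : ℝ → ℝ) = fun x => s - I g x := funext hgx
    have hIx : I g x = s - g x := by linarith [hgx x]
    change HasDerivAt (fun x => s - I g x) (-((A * I g x - E g x) / x ^ 2)) x at hd
    rw [← hfun, hIx] at hd
    convert hd using 1
    simp only [hE_def]
    ring

/-! ### The capital paths and the optimality condition -/

/-- Global solution of `x' = x φ(x)` for `φ` negative and bounded away from `0`: in the form
`x = x₀ exp (-z)` the equation is `z' = -φ(x₀ exp (-z))`, solved by separation of variables. -/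
theorem exists_decaying_path {φ : ℝ → ℝ} (hφ : Continuous φ) {l L : ℝ} (hl : 0 < l)
    (hlo : ∀ x, -L ≤ φ x) (hhi : ∀ x, φ x ≤ -l) (x₀ : ℝ) :
    ∃ x : ℝ → ℝ, x 0 = x₀ ∧ (∀ t, HasDerivAt x (x t * φ (x t)) t) ∧
      (∀ t, 0 ≤ t → |x t| ≤ |x₀| * Real.exp (-l * t)) ∧ (x₀ ≠ 0 → ∀ t, x t ≠ 0) ∧
      (x₀ = 0 → ∀ t, x t = 0) := by
  have hL : 0 < L := by linarith [hlo 0, hhi 0]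
  set Φ : ℝ → ℝ := fun z => -φ (x₀ * Real.exp (-z)) with hΦ
  have hΦc : Continuous Φ := by fun_prop
  have hΦl : ∀ z, l ≤ Φ z := fun z => by linarith [hhi (x₀ * Real.exp (-z))]
  have hΦL : ∀ z, Φ z ≤ L := fun z => by linarith [hlo (x₀ * Real.exp (-z))]
  have hΦ0 : ∀ z, 0 < Φ z := fun z => hl.trans_le (hΦl z)
  have hic : Continuous fun z => (Φ z)⁻¹ := hΦc.inv₀ fun z => (hΦ0 z).ne'
  -- The time at which `x₀ * exp (-z)` is reached.
  set τ : ℝ → ℝ := fun z => ∫ y in (0 : ℝ)..z, (Φ y)⁻¹ with hτ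
  have hτ' : ∀ z, HasDerivAt τ (Φ z)⁻¹ z := fun z =>
    intervalIntegral.integral_hasDerivAt_right (hic.intervalIntegrable _ _)
      (hic.stronglyMeasurableAtFilter _ _) hic.continuousAt
  have hτ0 : τ 0 = 0 := by simp [hτ]
  have hmono : StrictMono τ := strictMono_of_deriv_pos fun z => by
    rw [(hτ' z).deriv]; exact inv_pos.2 (hΦ0 z)
  have hτc : Continuous τ := continuous_iff_continuousAt.2 fun z => (hτ' z).continuousAt
  have hgrow : Monotone fun z => τ z - z / L := by
    have hd : ∀ z, HasDerivAt (fun z => τ z - z / L) ((Φ z)⁻¹ - 1 / L) z := fun z =>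
      (hτ' z).sub ((hasDerivAt_id z).div_const L)
    refine monotone_of_deriv_nonneg (fun z => (hd z).differentiableAt) fun z => ?_
    rw [(hd z).deriv, one_div, sub_nonneg]
    exact inv_anti₀ (hΦ0 z) (hΦL z)
  have hsurj : Function.Surjective τ := by
    refine hτc.surjective ?_ ?_
    · refine tendsto_atTop_mono' _ ?_ (tendsto_id.atTop_div_const hL)
      filter_upwards [eventually_ge_atTop 0] with z hz
      have := hgrow hz
      simp only [hτ0, zero_div, sub_zero, id] at this ⊢
      linarith
    · refine tendsto_atBot_mono' _ ?_ (tendsto_id.atBot_div_const hL)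
      filter_upwards [eventually_le_atBot 0] with z hz
      have := hgrow hz
      simp only [hτ0, zero_div, sub_zero, id] at this ⊢
      linarith
  set o := hmono.orderIsoOfSurjective τ hsurj with ho
  have hoz : ∀ t, τ (o.symm t) = t := fun t => o.apply_symm_apply t
  have hz0 : o.symm 0 = 0 := by
    apply hmono.injective
    rw [hoz, hτ0]
  have hz' : ∀ t, HasDerivAt (fun t => o.symm t) (Φ (o.symm t)) t := fun t => by
    have := HasDerivAt.of_local_left_inverse (f := τ) (g := fun t => o.symm t) (a := t)
      (o.symm.continuous.continuousAt) (hτ' _) (inv_ne_zero (hΦ0 _).ne')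
      (Eventually.of_forall hoz)
    rwa [inv_inv] at this
  have hzl : ∀ t, 0 ≤ t → l * t ≤ o.symm t := by
    have hd : ∀ t, HasDerivAt (fun t => o.symm t - l * t) (Φ (o.symm t) - l * 1) t := fun t =>
      (hz' t).sub ((hasDerivAt_id t).const_mul l)
    have hm : Monotone fun t => o.symm t - l * t := by
      refine monotone_of_deriv_nonneg (fun z => (hd z).differentiableAt) fun z => ?_
      rw [(hd z).deriv]
      linarith [hΦl (o.symm z)]
    intro t ht
    have := hm ht
    simp only [hz0] at this
    linarith
  refine ⟨fun t => x₀ * Real.exp (-o.symm t), by simp [hz0], fun t => ?_, fun t ht => ?_,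
    fun h t => mul_ne_zero h (Real.exp_pos _).ne', fun h t => by simp [h]⟩
  · refine (((hz' t).fun_neg.exp).const_mul x₀).congr_deriv ?_
    simp only [hΦ]
    ring
  · rw [abs_mul, abs_of_pos (Real.exp_pos _)]
    gcongr
    linarith [hzl t ht]

theorem integrableOn_olgDiscount_mul {π δ ρ : ℝ} (hπδ : 0 < δ + π) (hρ : 0 < ρ) {E : ℝ → ℝ}
    (hE : ContinuousOn E (Ici 0)) {M : ℝ} (hM : ∀ t, 0 ≤ t → |E t| ≤ M) :
    IntegrableOn (fun t => olgDiscount π δ ρ t * E t) (Ioi 0) := by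
  have h : ∀ {A : ℝ}, 0 < A → IntegrableOn (fun t => Real.exp (-A * t) * E t) (Ioi 0) :=
    fun hA => integrableOn_exp_mul_of_bounded hA (hE.mono Ioi_subset_Ici_self)
      fun r hr => hM r (le_of_lt hr)
  refine IntegrableOn.congr_fun (((h hπδ).const_mul ((δ - ρ) / (π + δ - ρ))).add
    ((h hρ).const_mul (π / (π + δ - ρ)))) (fun t _ => ?_) measurableSet_Ioi
  simp only [olgDiscount, Pi.add_apply]
  ring

theorem log_sub_log_add_lt {c y : ℝ} (hc : 0 < c) (hy : 0 < y) (hcy : c ≠ y) :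
    Real.log c - Real.log y + (y - c) / y < 0 := by
  have h := Real.log_lt_sub_one_of_pos (div_pos hc hy) (by rwa [Ne, div_eq_one_iff_eq hy.ne'])
  rw [Real.log_div hc.ne' hy.ne'] at h
  have : (y - c) / y = 1 - c / y := by field_simp
  linarith

/-- Verification: `σ` is optimal at `k` if there is a function `p` (the marginal value of capital for
the discount function `exp (-ρ t)`) which satisfies the Bellman equation for that discount
function, differentiated in `k`, along the capital path, and which is related to `σ` by the
corresponding equation for the other exponential. The Bellman equation is stated along the path, so
that `p` need not be differentiable at the steady state. -/
theorem isOptimalAt_of_multiplier {π δ ρ : ℝ} (hπδ : 0 < δ + π) (hρ : 0 < ρ)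
    (hγ : π + δ - ρ ≠ 0) {f σ p κ : ℝ → ℝ} {Ω K : Set ℝ} {k : ℝ} (hΩ : IsOpen Ω)
    (hK : IsCompact K) (hKΩ : K ⊆ Ω)
    (hf' : ContinuousOn (deriv f) Ω) (hσ : ContDiffOn ℝ 1 σ Ω) (hσpos : ∀ k ∈ Ω, 0 < σ k)
    (hstab : ∀ k ∈ Ω, deriv f k - deriv σ k ≤ 0) (hp : ContinuousOn p Ω)
    (hpσ : ∀ k ∈ Ω, π * p k * σ k = π + δ - deriv f k + deriv σ k * (f k - σ k) / σ k)
    (hκ0 : κ 0 = k) (hκK : ∀ t, 0 ≤ t → κ t ∈ K)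
    (hκ : ∀ t, 0 ≤ t → HasDerivAt κ (f (κ t) - σ (κ t)) t)
    (hpκ : ∀ t, 0 ≤ t → HasDerivAt (fun t => p (κ t)) (ρ * p (κ t) - deriv σ (κ t) / σ (κ t) -
      p (κ t) * (deriv f (κ t) - deriv σ (κ t))) t) :
    IsOptimalAt f (olgDiscount π δ ρ) Real.log Ω σ k := by
  have hκΩ : ∀ t, 0 ≤ t → κ t ∈ Ω := fun t ht => hKΩ (hκK t ht)
  have hκc : ContinuousOn κ (Ici 0) := fun t ht => (hκ t ht).continuousAt.continuousWithinAt
  have hσ' : ContinuousOn (deriv σ) Ω := hσ.continuousOn_deriv_of_isOpen hΩ le_rfl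
  have hσd : ∀ k ∈ Ω, HasDerivAt σ (deriv σ k) k := fun k hk =>
    ((hσ.differentiableOn one_ne_zero).differentiableAt (hΩ.mem_nhds hk)).hasDerivAt
  -- Functions continuous on `Ω` are continuous and bounded along the path.
  have hcomp : ∀ {G : ℝ → ℝ}, ContinuousOn G Ω → ContinuousOn (fun t => G (κ t)) (Ici 0) :=
    fun hG => hG.comp hκc fun t ht => hκΩ t ht
  have hbdd : ∀ {G : ℝ → ℝ}, ContinuousOn G Ω → ∃ M, ∀ t, 0 ≤ t → |G (κ t)| ≤ M := by
    intro G hG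
    obtain ⟨M, hM⟩ := hK.exists_bound_of_continuousOn (hG.mono hKΩ)
    exact ⟨M, fun t ht => hM _ (hκK t ht)⟩
  -- The solution `N` of the linearized equation with `N 0 = 1`.
  set D : ℝ → ℝ := fun t => deriv f (κ (max t 0)) - deriv σ (κ (max t 0)) with hD
  have hDc : Continuous D := by
    have := (hcomp (hf'.sub hσ')).comp_continuous (f := fun t : ℝ => max t 0) (by fun_prop)
      fun t => le_max_right t 0
    exact this
  have hDt : ∀ t, 0 ≤ t → D t = deriv f (κ t) - deriv σ (κ t) := fun t ht => by
    simp only [hD, max_eq_left ht]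
  set N : ℝ → ℝ := fun t => Real.exp (∫ r in (0 : ℝ)..t, D r) with hN
  have hN' : ∀ t, HasDerivAt N (D t * N t) t := fun t => by
    have := (intervalIntegral.integral_hasDerivAt_right (hDc.intervalIntegrable 0 t)
      (hDc.stronglyMeasurableAtFilter _ _) hDc.continuousAt).exp
    exact this.congr_deriv (mul_comm _ _)
  have hNc : Continuous N := continuous_iff_continuousAt.2 fun t => (hN' t).continuousAt
  have hN0 : N 0 = 1 := by simp [hN]
  have hN1 : ∀ t, 0 ≤ t → |N t| ≤ 1 := fun t ht => by
    rw [abs_of_pos (Real.exp_pos _), Real.exp_le_one_iff]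
    have := intervalIntegral.integral_mono_on ht (hDc.intervalIntegrable 0 t)
      (continuous_const.intervalIntegrable (μ := volume) (u := fun _ : ℝ => (0 : ℝ)) 0 t)
      fun r hr => by rw [hDt r hr.1]; exact hstab _ (hκΩ r hr.1)
    simpa using this
  have hbN : ∀ {G : ℝ → ℝ}, ContinuousOn G Ω → ∃ M, ∀ t, 0 ≤ t → |G (κ t) * N t| ≤ M := by
    intro G hG
    obtain ⟨M, hM⟩ := hbdd hG
    refine ⟨M, fun t ht => ?_⟩
    rw [abs_mul]
    calc _ ≤ M * 1 := mul_le_mul (hM t ht) (hN1 t ht) (abs_nonneg _)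
          ((abs_nonneg _).trans (hM t ht))
      _ = M := mul_one M
  have hσinv : ContinuousOn (fun k => (σ k)⁻¹) Ω :=
    hσ.continuousOn.inv₀ fun k hk => (hσpos k hk).ne'
  have hW : IntegrableOn (fun t => olgDiscount π δ ρ t * ((σ (κ t))⁻¹ * deriv σ (κ t) * N t))
      (Ioi 0) := by
    obtain ⟨M, hM⟩ := hbN (hσinv.mul hσ')
    exact integrableOn_olgDiscount_mul hπδ hρ ((hcomp (hσinv.mul hσ')).mul hNc.continuousOn) hM
  set b := π / (π + δ - ρ) with hb
  -- `b * p` and `1 / σ - b * p` are the contributions of the two exponentials to `1 / σ`.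
  -- Hence `J` is an antiderivative of the integrand, with `J 0 = -1 / σ k` and `J → 0`.
  set J : ℝ → ℝ := fun t => -(Real.exp (-(δ + π) * t) * (((σ (κ t))⁻¹ - b * p (κ t)) * N t) +
    Real.exp (-ρ * t) * (b * p (κ t) * N t)) with hJ
  have hJ' : ∀ t, 0 ≤ t → HasDerivAt J
      (olgDiscount π δ ρ t * ((σ (κ t))⁻¹ * deriv σ (κ t) * N t)) t := by
    intro t ht
    have hs := (hσpos _ (hκΩ t ht)).ne'
    have e1 : ∀ A : ℝ, HasDerivAt (fun t => Real.exp (-A * t)) (Real.exp (-A * t) * (-A * 1)) t :=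
      fun A => ((hasDerivAt_id t).const_mul (-A)).exp
    have e2 := ((hσd _ (hκΩ t ht)).comp t (hκ t ht)).inv hs
    have e3 := (hpκ t ht).const_mul b
    have e4 := hN' t
    have e5 := (((e1 (δ + π)).mul ((e2.sub e3).mul e4)).add ((e1 ρ).mul (e3.mul e4))).neg
    refine e5.congr_deriv ?_
    have h1 := hpσ _ (hκΩ t ht)
    have hbγ : (π + δ - ρ) * b = π := by rw [hb]; field_simp
    have ha : (δ - ρ) / (π + δ - ρ) = 1 - b := by rw [hb]; field_simp; ring
    simp only [olgDiscount, ha, ← hb, hDt t ht, Function.comp_apply, Pi.mul_apply, Pi.sub_apply,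
      Pi.inv_apply]
    set S := σ (κ t)
    set P := p (κ t)
    set F₀ := f (κ t)
    set F₁ := deriv f (κ t)
    set g := deriv σ (κ t)
    have h2 : (π + δ - ρ) * b * P = (π + δ - F₁ + g * (F₀ - S) / S) / S := by
      rw [hbγ]; field_simp; field_simp at h1; linear_combination h1
    have h3 : -(g * (F₀ - S)) / S ^ 2 = -(g * (F₀ - S) / S) / S := by field_simp
    have h4 : g / S = g * S⁻¹ := by ring
    rw [h3]
    linear_combination (-Real.exp (-(δ + π) * t) * N t) * h2
  have hJlim : Tendsto J atTop (𝓝 0) := by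
    have e1 : ∀ {A : ℝ}, 0 < A → Tendsto (fun t => Real.exp (-A * t)) atTop (𝓝 0) := fun hA =>
      Real.tendsto_exp_atBot.comp ((tendsto_const_mul_atBot_of_neg (by linarith)).2 tendsto_id)
    have e2 : ∀ {A : ℝ} {G : ℝ → ℝ}, 0 < A → ContinuousOn G Ω →
        Tendsto (fun t => Real.exp (-A * t) * (G (κ t) * N t)) atTop (𝓝 0) := by
      intro A G hA hG
      obtain ⟨M, hM⟩ := hbN hG
      refine (e1 hA).zero_mul_isBoundedUnder_le ⟨M, ?_⟩
      rw [eventually_map]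
      filter_upwards [eventually_ge_atTop 0] with t ht
      exact hM t ht
    have := ((e2 (G := fun k => (σ k)⁻¹ - b * p k) hπδ (hσinv.sub (hp.const_smul b))).add
      (e2 (G := fun k => b * p k) hρ (hp.const_smul b))).neg
    rwa [add_zero, neg_zero] at this
  have hint : ∫ t in Ioi (0 : ℝ),
      olgDiscount π δ ρ t * ((σ (κ t))⁻¹ * deriv σ (κ t) * N t) = (σ k)⁻¹ := by
    rw [integral_Ioi_of_hasDerivAt_of_tendsto (hJ' 0 le_rfl).continuousAt.continuousWithinAt
      (fun t ht => hJ' t (le_of_lt ht)) hW hJlim]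
    simp [hJ, hN0, hκ0]
  have hvi : ∀ c t, variationIntegrand (olgDiscount π δ ρ) Real.log σ κ
      (fun t => (σ k - c) * N t) t =
      (σ k - c) * (olgDiscount π δ ρ t * ((σ (κ t))⁻¹ * deriv σ (κ t) * N t)) := fun c t => by
    simp only [variationIntegrand, Real.deriv_log]
    ring
  refine ⟨κ, ⟨hκ0, hκΩ, fun t ht => (hκ t ht).hasDerivWithinAt⟩, ?_,
    fun c t => (σ k - c) * N t, fun c _ => ⟨by simp [hN0], fun t ht => ?_⟩, fun c _ => ?_,
    fun c hc hck => ?_⟩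
  · have hlog : ContinuousOn (fun k => Real.log (σ k)) Ω :=
      hσ.continuousOn.log fun k hk => (hσpos k hk).ne'
    obtain ⟨M, hM⟩ := hbdd hlog
    exact integrableOn_olgDiscount_mul hπδ hρ (hcomp hlog) hM
  · rw [← hDt t ht]
    exact (((hN' t).const_mul (σ k - c)).congr_deriv (by ring)).hasDerivWithinAt
  · rw [funext (hvi c)]
    exact hW.const_mul _
  · have hgain : ∀ c, firstOrderGain (olgDiscount π δ ρ) Real.log σ k κ
        (fun t => (σ k - c) * N t) c = Real.log c - Real.log (σ k) + (σ k - c) / σ k := fun c => by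
      rw [firstOrderGain, funext (hvi c), integral_const_mul, hint, div_eq_mul_inv]
    have hk : k ∈ Ω := hκ0 ▸ hκΩ 0 le_rfl
    rw [hgain, hgain, sub_self, sub_self, zero_div, add_zero]
    exact log_sub_log_add_lt hc (hσpos k hk) hck

/-! ### The remainder of the singular equation -/

/-- The value of `F² g'` dictated by the equilibrium condition, at a capital stock where `f`, `f'`,
`f''` take the values `f₀`, `f₁`, `f₂`, net investment is `F`, consumption is `f₀ - F`, and
`σ' = y`. -/
noncomputable def slowNumerator (π δ ρ F f₀ f₁ f₂ y : ℝ) : ℝ :=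
  (f₀ - F) * (f₂ * F - F * y * (f₁ - y) / (f₀ - F) + y ^ 2 * F ^ 2 / (f₀ - F) ^ 2 +
    (ρ - f₁) * (π + δ - f₁ + y * F / (f₀ - F)) + y * (δ - f₁ + y * F / (f₀ - F)) +
    (π + δ - f₁ + y * F / (f₀ - F)) * (y * F / (f₀ - F)))

/-- The difference between `x² g'`, as the equilibrium condition gives it when `F = x φ`, and its
linear part `A (g - s)`. -/
noncomputable def slowRemainder (π δ ρ A s x f₀ f₁ f₂ φ y : ℝ) : ℝ :=
  slowNumerator π δ ρ (x * φ) f₀ f₁ f₂ y / φ ^ 2 - A * (y - s)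

/-- The equation that determines `s` says that the remainder vanishes at the steady state. -/
theorem slowRemainder_zero {π δ ρ A s f₀ f₁ f₂ φ : ℝ}
    (hs : s * (δ - f₁) = (f₁ - ρ) * (π + δ - f₁)) :
    slowRemainder π δ ρ A s 0 f₀ f₁ f₂ φ s = 0 := by
  have : (ρ - f₁) * (π + δ - f₁) + s * (δ - f₁) = 0 := by linear_combination hs
  simp [slowRemainder, slowNumerator, this]

theorem contDiffAt_slowRemainder {π δ ρ A s x f₀ f₁ f₂ φ y : ℝ} (hS : f₀ - x * φ ≠ 0)
    (hφ : φ ≠ 0) :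
    ContDiffAt ℝ 1 (fun q : (ℝ × ℝ × ℝ × ℝ) × ℝ × ℝ =>
      slowRemainder π δ ρ A s q.1.1 q.1.2.1 q.1.2.2.1 q.1.2.2.2 q.2.1 q.2.2)
      ((x, f₀, f₁, f₂), φ, y) := by
  unfold slowRemainder slowNumerator
  have h1 : ∀ n : ℕ, (f₀ - x * φ) ^ n ≠ 0 := fun n => pow_ne_zero n hS
  have h2 : φ ^ 2 ≠ 0 := pow_ne_zero 2 hφ
  have hq : ContDiffAt ℝ 1 (fun q : (ℝ × ℝ × ℝ × ℝ) × ℝ × ℝ => q.1.2.1 - q.1.1 * q.2.1)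
    ((x, f₀, f₁, f₂), φ, y) := by fun_prop
  have hr : ContDiffAt ℝ 1 (fun q : (ℝ × ℝ × ℝ × ℝ) × ℝ × ℝ => (q.1.2.1 - q.1.1 * q.2.1)⁻¹)
    ((x, f₀, f₁, f₂), φ, y) := hq.inv hS
  have ht : ContDiffAt ℝ 1 (fun q : (ℝ × ℝ × ℝ × ℝ) × ℝ × ℝ => (q.2.1)⁻¹)
    ((x, f₀, f₁, f₂), φ, y) := ContDiffAt.inv (by fun_prop) hφ
  simp only [div_eq_mul_inv, ← inv_pow]
  fun_prop

/-- Near the steady state the remainder is Lipschitz in `(φ, y)` with an arbitrarily small constant.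
It is a smooth function of these and of `c = (x, f₀, f₁, f₂)`, so strict differentiability gives the
estimate uniformly in `c`; in particular no derivative of `f''` is needed. -/
theorem exists_slowRemainder_lipschitz {π δ ρ A s l f₀ f₁ f₂ κ : ℝ} (hf₀ : f₀ ≠ 0) (hl : l ≠ 0)
    (hs : s * (δ - f₁) = (f₁ - ρ) * (π + δ - f₁)) (hA : A = f₀ * (δ - f₁) / l ^ 2) (hκ : 0 < κ) :
    ∃ r > 0, ∀ c : ℝ × ℝ × ℝ × ℝ, dist c (0, f₀, f₁, f₂) < r → ∀ φ y φ' y',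
      |φ + l| < r → |y - s| < r → |φ' + l| < r → |y' - s| < r →
      |slowRemainder π δ ρ A s c.1 c.2.1 c.2.2.1 c.2.2.2 φ y -
        slowRemainder π δ ρ A s c.1 c.2.1 c.2.2.1 c.2.2.2 φ' y'| ≤
        κ * max |φ - φ'| |y - y'| := by
  set G : (ℝ × ℝ × ℝ × ℝ) × ℝ × ℝ → ℝ := fun q =>
      slowRemainder π δ ρ A s q.1.1 q.1.2.1 q.1.2.2.1 q.1.2.2.2 q.2.1 q.2.2 with hG
  set q₀ : (ℝ × ℝ × ℝ × ℝ) × ℝ × ℝ := ((0, f₀, f₁, f₂), -l, s) with hq₀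
  have hcd : ContDiffAt ℝ 1 G q₀ :=
    contDiffAt_slowRemainder (by simpa using hf₀) (neg_ne_zero.2 hl)
  have hstrict : HasStrictFDerivAt G (fderiv ℝ G q₀) q₀ := hcd.hasStrictFDerivAt one_ne_zero
  -- The derivative in the last two variables vanishes, by the choice of `A`.
  have hker : ∀ a b : ℝ, fderiv ℝ G q₀ (0, a, b) = 0 := by
    intro a b
    have hline : HasDerivAt (fun t : ℝ => q₀ + t • ((0, a, b) : (ℝ × ℝ × ℝ × ℝ) × ℝ × ℝ))
        (0, a, b) 0 := by
      simpa using ((hasDerivAt_id (0 : ℝ)).smul_const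
        ((0, a, b) : (ℝ × ℝ × ℝ × ℝ) × ℝ × ℝ)).const_add q₀
    have h1 : HasDerivAt (fun t : ℝ => G (q₀ + t • ((0, a, b) : (ℝ × ℝ × ℝ × ℝ) × ℝ × ℝ)))
        (fderiv ℝ G q₀ (0, a, b)) 0 := by
      have h : HasFDerivAt G (fderiv ℝ G q₀)
          (q₀ + (0 : ℝ) • ((0, a, b) : (ℝ × ℝ × ℝ × ℝ) × ℝ × ℝ)) := by
        simpa using hstrict.hasFDerivAt
      exact h.comp_hasDerivAt (0 : ℝ) hline
    have h2 : (fun t : ℝ => G (q₀ + t • ((0, a, b) : (ℝ × ℝ × ℝ × ℝ) × ℝ × ℝ))) =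
        fun t => (t * b) * (f₀ * (δ - f₁) / (-l + t * a) ^ 2 - A) := by
      funext t
      have h3 : (ρ - f₁) * (π + δ - f₁) + (s + t * b) * (δ - f₁) = t * b * (δ - f₁) := by
        linear_combination hs
      simp only [hG, hq₀, slowRemainder, slowNumerator, Prod.mk_add_mk, Prod.smul_mk, smul_zero,
        smul_eq_mul, zero_mul, mul_zero,
        add_zero, sub_zero, zero_div, zero_add, ne_eq, OfNat.ofNat_ne_zero, not_false_eq_true,
        zero_pow, h3]
      ring
    have h4 : HasDerivAt (fun t : ℝ => (t * b) * (f₀ * (δ - f₁) / (-l + t * a) ^ 2 - A)) 0 0 := by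
      have hc : ContinuousAt (fun t : ℝ => f₀ * (δ - f₁) / (-l + t * a) ^ 2 - A) 0 := by
        refine ContinuousAt.sub (ContinuousAt.div (by fun_prop) (by fun_prop) ?_) (by fun_prop)
        simpa using hl
      rw [hasDerivAt_iff_tendsto_slope]
      have hlim : Tendsto (fun t : ℝ => b * (f₀ * (δ - f₁) / (-l + t * a) ^ 2 - A)) (𝓝[≠] 0)
          (𝓝 0) := by
        have := (hc.const_mul b).tendsto.mono_left (nhdsWithin_le_nhds (s := {0}ᶜ))
        simpa [hA] using this
      refine hlim.congr' ?_
      filter_upwards [self_mem_nhdsWithin] with t ht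
      have ht : t ≠ 0 := ht
      simp only [slope_def_field, zero_mul, sub_zero]
      rw [mul_assoc, mul_div_cancel_left₀ _ ht]
    rw [h2] at h1
    exact h1.unique h4
  have hev := hstrict.isLittleO.def hκ
  obtain ⟨r, hr, hball⟩ := Metric.eventually_nhds_iff.1 hev
  refine ⟨r, hr, fun c hc φ y φ' y' h1 h2 h3 h4 => ?_⟩
  have hd : ∀ φ y : ℝ, |φ + l| < r → |y - s| < r → dist (c, φ, y) q₀ < r := by
    intro φ y h1 h2
    simp only [hq₀, Prod.dist_eq, Real.dist_eq] at hc ⊢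
    simp only [max_lt_iff, sub_neg_eq_add] at hc ⊢
    exact ⟨hc, h1, h2⟩
  have := hball (y := ((c, φ, y), (c, φ', y')))
    (by rw [Prod.dist_eq]; exact max_lt (hd _ _ h1 h2) (hd _ _ h3 h4))
  simp only [Prod.mk_sub_mk, sub_self, hker, sub_zero] at this
  simpa [hG, Prod.norm_def, Real.norm_eq_abs] using this

/-! ### Solution of the singular equation near a steady state -/

/-- The point of `[c - r, c + r]` nearest to `y`. -/
noncomputable def clamp (c r y : ℝ) : ℝ := max (c - r) (min y (c + r))

theorem continuous_clamp (c r : ℝ) : Continuous (clamp c r) := by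
  unfold clamp; fun_prop

theorem abs_clamp_sub_le {c r : ℝ} (hr : 0 ≤ r) (y : ℝ) : |clamp c r y - c| ≤ r := by
  unfold clamp
  rw [abs_le]
  exact ⟨by linarith [le_max_left (c - r) (min y (c + r))],
    by linarith [max_le (by linarith : c - r ≤ c + r) (min_le_right y (c + r))]⟩

theorem clamp_of_abs_le {c r y : ℝ} (h : |y - c| ≤ r) : clamp c r y = y := by
  obtain ⟨h1, h2⟩ := abs_le.1 h
  rw [clamp, min_eq_left (by linarith), max_eq_right (by linarith)]

theorem abs_clamp_sub_clamp_le (c r y y' : ℝ) : |clamp c r y - clamp c r y'| ≤ |y - y'| := by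
  unfold clamp
  refine (abs_max_sub_max_le_max _ _ _ _).trans ?_
  rw [sub_self, abs_zero, max_eq_right (abs_nonneg _)]
  refine (abs_min_sub_min_le_max _ _ _ _).trans ?_
  rw [sub_self, abs_zero, max_eq_left (abs_nonneg _)]

/-- Existence of the slope `g = σ'` of an equilibrium strategy near a stable steady state at `x = 0`,
for a production function with value and derivatives `f₀`, `f₁`, `f₂`. Net investment is `x φ x`. -/
theorem exists_slow_strategy {π δ ρ : ℝ} {f₀ f₁ f₂ : ℝ → ℝ} {ε₀ s l : ℝ} (hε₀ : 0 < ε₀)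
    (hc₀ : ContinuousOn f₀ (Icc (-ε₀) ε₀)) (hc₁ : ContinuousOn f₁ (Icc (-ε₀) ε₀))
    (hc₂ : ContinuousOn f₂ (Icc (-ε₀) ε₀)) (hpos : 0 < f₀ 0) (hδ : f₁ 0 < δ) (hl : 0 < l)
    (hs : s * (δ - f₁ 0) = (f₁ 0 - ρ) * (π + δ - f₁ 0)) (hls : f₁ 0 - s = -l) :
    ∃ ε > 0, ε ≤ ε₀ ∧ ∃ g φ : ℝ → ℝ, Continuous g ∧ Continuous φ ∧ g 0 = s ∧
      (∀ x, -(2 * l) ≤ φ x) ∧ (∀ x, φ x ≤ -(l / 2)) ∧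
      ∀ x, |x| < ε → x * φ x = (∫ y in (0 : ℝ)..x, (f₁ y - g y)) ∧ 0 < f₀ x - x * φ x ∧
        f₁ x - g x ≤ 0 ∧
        (x ≠ 0 → HasDerivAt g
          (slowNumerator π δ ρ (x * φ x) (f₀ x) (f₁ x) (f₂ x) (g x) / (x * φ x) ^ 2) x) := by
  set A := f₀ 0 * (δ - f₁ 0) / l ^ 2 with hA
  have hA0 : 0 < A := by have := sub_pos.2 hδ; positivity
  obtain ⟨r, hr, hlip⟩ := exists_slowRemainder_lipschitz (κ := A / 4) (f₂ := f₂ 0) hpos.ne' hl.ne'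
    hs hA (by positivity)
  obtain ⟨η, hη, hηr, hηl⟩ : ∃ η > 0, 2 * η < r ∧ 2 * η ≤ l / 2 :=
    ⟨min (r / 4) (l / 4), by positivity, by linarith [min_le_left (r / 4) (l / 4)],
      by linarith [min_le_right (r / 4) (l / 4)]⟩
  have hnh : Icc (-ε₀) ε₀ ∈ 𝓝 (0 : ℝ) := Icc_mem_nhds (by linarith) hε₀
  have ha₀ := hc₀.continuousAt hnh
  have ha₁ := hc₁.continuousAt hnh
  have ha₂ := hc₂.continuousAt hnh
  have hev : ∀ᶠ x in 𝓝 (0 : ℝ), dist (x, f₀ x, f₁ x, f₂ x) (0, f₀ 0, f₁ 0, f₂ 0) < r ∧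
      |slowRemainder π δ ρ A s x (f₀ x) (f₁ x) (f₂ x) (-l) s| < A / 2 * η ∧
      |f₁ x - f₁ 0| < η ∧ 2 * l * |x| < f₀ x := by
    refine ((continuousAt_id.prodMk (ha₀.prodMk (ha₁.prodMk ha₂))).eventually
      (Metric.ball_mem_nhds _ hr)).and (Eventually.and ?_ (Eventually.and ?_ ?_))
    · have hca : ContinuousAt (fun x => |slowRemainder π δ ρ A s x (f₀ x) (f₁ x) (f₂ x) (-l) s|)
          0 := by
        have h := (contDiffAt_slowRemainder (π := π) (δ := δ) (ρ := ρ) (A := A) (s := s) (x := 0)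
          (f₀ := f₀ 0) (f₁ := f₁ 0) (f₂ := f₂ 0) (φ := -l) (y := s) (by simpa using hpos.ne')
          (by simpa using hl.ne')).continuousAt
        have hin : ContinuousAt (fun x => (((x, f₀ x, f₁ x, f₂ x), -l, s) :
            (ℝ × ℝ × ℝ × ℝ) × ℝ × ℝ)) 0 :=
          (continuousAt_id.prodMk (ha₀.prodMk (ha₁.prodMk ha₂))).prodMk continuousAt_const
        exact (ContinuousAt.comp (f := fun x => (((x, f₀ x, f₁ x, f₂ x), -l, s) :
            (ℝ × ℝ × ℝ × ℝ) × ℝ × ℝ)) h hin).abs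
      refine hca.eventually_lt continuousAt_const ?_
      rw [slowRemainder_zero hs, abs_zero]
      positivity
    · refine (ha₁.sub continuousAt_const).abs.eventually_lt continuousAt_const ?_
      simpa using hη
    · refine ContinuousAt.eventually_lt (by fun_prop) ha₀ ?_
      simpa using hpos
  obtain ⟨ε₁, hε₁, hball⟩ := Metric.eventually_nhds_iff.1 hev
  set ε := min ε₀ (ε₁ / 2) with hε
  have hε0 : 0 < ε := by positivity
  have hεε₁ : ε < ε₁ := (min_le_right _ _).trans_lt (by linarith)
  have hP : ∀ x, |x| ≤ ε → dist (x, f₀ x, f₁ x, f₂ x) (0, f₀ 0, f₁ 0, f₂ 0) < r ∧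
      |slowRemainder π δ ρ A s x (f₀ x) (f₁ x) (f₂ x) (-l) s| < A / 2 * η ∧
      |f₁ x - f₁ 0| < η ∧ 2 * l * |x| < f₀ x := fun x hx => by
    refine hball ?_
    rw [Real.dist_eq, sub_zero]
    exact hx.trans_lt hεε₁
  -- Everything is extended to the whole line by clamping the arguments.
  set C := clamp 0 ε with hC
  have hCε : ∀ x, |C x| ≤ ε := fun x => by
    have := abs_clamp_sub_le (c := 0) hε0.le x
    rwa [sub_zero] at this
  have hCx : ∀ x, |x| ≤ ε → C x = x := fun x hx => clamp_of_abs_le (by simpa using hx)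
  have hCc : Continuous C := continuous_clamp _ _
  have hCI : ∀ x, C x ∈ Icc (-ε₀) ε₀ := fun x =>
    abs_le.1 ((hCε x).trans (min_le_left _ _))
  have hC0 : C 0 = 0 := hCx 0 (by simpa using hε0.le)
  have hcl₀ : Continuous fun x => f₀ (C x) := hc₀.comp_continuous hCc hCI
  have hcl₁ : Continuous fun x => f₁ (C x) := hc₁.comp_continuous hCc hCI
  have hcl₂ : Continuous fun x => f₂ (C x) := hc₂.comp_continuous hCc hCI
  set Φ := clamp (-l) (2 * η) with hΦ
  set Y := clamp s η with hY
  have hΦl : ∀ φ, |Φ φ + l| ≤ 2 * η := fun φ => by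
    have := abs_clamp_sub_le (c := -l) (by positivity : 0 ≤ 2 * η) φ
    rwa [sub_neg_eq_add] at this
  have hYs : ∀ y, |Y y - s| ≤ η := fun y => abs_clamp_sub_le hη.le y
  have hΦbd : ∀ φ, -(2 * l) ≤ Φ φ ∧ Φ φ ≤ -(l / 2) := fun φ => by
    obtain ⟨h1, h2⟩ := abs_le.1 (hΦl φ)
    exact ⟨by linarith, by linarith⟩
  have hSpos : ∀ x φ, |x| ≤ ε → -(2 * l) ≤ φ → φ ≤ -(l / 2) → 0 < f₀ x - x * φ := by
    intro x φ hx h1 h2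
    have h3 : |x * φ| ≤ 2 * l * |x| := by
      rw [abs_mul, mul_comm]
      gcongr
      exact abs_le.2 ⟨h1, by linarith⟩
    linarith [(hP x hx).2.2.2, le_abs_self (x * φ)]
  set e : ℝ → ℝ → ℝ → ℝ := fun x φ y =>
    slowRemainder π δ ρ A s (C x) (f₀ (C x)) (f₁ (C x)) (f₂ (C x)) (Φ φ) (Y y) with he
  have hec : Continuous fun q : ℝ × ℝ × ℝ => e q.1 q.2.1 q.2.2 := by
    rw [continuous_iff_continuousAt]
    intro q
    have h := (contDiffAt_slowRemainder (π := π) (δ := δ) (ρ := ρ) (A := A) (s := s) (x := C q.1)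
          (f₀ := f₀ (C q.1)) (f₁ := f₁ (C q.1)) (f₂ := f₂ (C q.1)) (φ := Φ q.2.1) (y := Y q.2.2)
          (hSpos _ _ (hCε _) (hΦbd _).1 (hΦbd _).2).ne'
          (by linarith [(hΦbd q.2.1).2] : Φ q.2.1 < 0).ne).continuousAt
    have hin : Continuous (fun q : ℝ × ℝ × ℝ =>
        (((C q.1, f₀ (C q.1), f₁ (C q.1), f₂ (C q.1)), Φ q.2.1, Y q.2.2) :
          (ℝ × ℝ × ℝ × ℝ) × ℝ × ℝ)) := by
      have hΦc : Continuous Φ := continuous_clamp _ _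
      have hYc : Continuous Y := continuous_clamp _ _
      have h1 := hcl₀.comp (continuous_fst (X := ℝ) (Y := ℝ × ℝ))
      have h2 := hcl₁.comp (continuous_fst (X := ℝ) (Y := ℝ × ℝ))
      have h3 := hcl₂.comp (continuous_fst (X := ℝ) (Y := ℝ × ℝ))
      exact ((hCc.comp continuous_fst).prodMk (h1.prodMk (h2.prodMk h3))).prodMk
        ((hΦc.comp (continuous_fst.comp continuous_snd)).prodMk
          (hYc.comp (continuous_snd.comp continuous_snd)))
    exact ContinuousAt.comp (f := fun q : ℝ × ℝ × ℝ =>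
        (((C q.1, f₀ (C q.1), f₁ (C q.1), f₂ (C q.1)), Φ q.2.1, Y q.2.2) :
          (ℝ × ℝ × ℝ × ℝ) × ℝ × ℝ)) h hin.continuousAt
  have helip : ∀ x φ y φ' y', |e x φ y - e x φ' y'| ≤ A / 4 * max |φ - φ'| |y - y'| := by
    intro x φ y φ' y'
    refine (hlip (C x, f₀ (C x), f₁ (C x), f₂ (C x)) (hP _ (hCε x)).1 (Φ φ) (Y y) (Φ φ') (Y y')
      ((hΦl φ).trans_lt hηr) ((hYs y).trans_lt (by linarith)) ((hΦl φ').trans_lt hηr)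
      ((hYs y').trans_lt (by linarith))).trans ?_
    exact mul_le_mul_of_nonneg_left (max_le_max (abs_clamp_sub_clamp_le _ _ _ _)
      (abs_clamp_sub_clamp_le _ _ _ _)) (by positivity)
  have heM : ∀ x φ y, |e x φ y| ≤ A * η := by
    intro x φ y
    have h1 := hlip (C x, f₀ (C x), f₁ (C x), f₂ (C x)) (hP _ (hCε x)).1 (Φ φ) (Y y) (-l) s
      ((hΦl φ).trans_lt hηr) ((hYs y).trans_lt (by linarith)) (by simpa using hr)
      (by simpa using hr)
    have h2 : max |Φ φ - -l| |Y y - s| ≤ 2 * η :=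
      max_le (by rw [sub_neg_eq_add]; exact hΦl φ) ((hYs y).trans (by linarith))
    have h3 := (hP _ (hCε x)).2.1
    have h4 : A / 4 * max |Φ φ - -l| |Y y - s| ≤ A / 4 * (2 * η) := by gcongr
    have h5 := abs_sub_abs_le_abs_sub (e x φ y)
      (slowRemainder π δ ρ A s (C x) (f₀ (C x)) (f₁ (C x)) (f₂ (C x)) (-l) s)
    simp only [he] at h5 ⊢
    simp only at h1
    linarith
  have hYsfix : Y s = s := clamp_of_abs_le (by simpa using hη.le)
  have he0 : ∀ φ, e 0 φ s = 0 := fun φ => by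
    change slowRemainder π δ ρ A s (C 0) (f₀ (C 0)) (f₁ (C 0)) (f₂ (C 0)) (Φ φ) (Y s) = 0
    rw [hC0, hYsfix]
    exact slowRemainder_zero hs
  obtain ⟨g, hgc, hgs, hg0, hg'⟩ := exists_slow_solution hA0 hε0 hcl₁ hec heM helip he0
  have hgη : ∀ x, |g x - s| ≤ η := fun x => by
    have := hgs x
    rwa [mul_div_cancel_left₀ _ hA0.ne'] at this
  set φ := meanSlope (fun x => f₁ (C x)) g with hφ
  have hφl : ∀ x, |φ x + l| ≤ 2 * η := by
    intro x
    have h := abs_meanSlope_sub_le (f₁' := fun _ => f₁ 0) (g' := fun _ => s) (d := 2 * η) hcl₁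
      continuous_const hgc continuous_const (fun y => ?_) x
    · have h2 : meanSlope (fun _ => f₁ 0) (fun _ => s) x = -l := by simp [meanSlope, hls]
      rwa [h2, sub_neg_eq_add] at h
    · have h1 := (hP _ (hCε y)).2.2.1.le
      calc |f₁ (C y) - g y - (f₁ 0 - s)| = |(f₁ (C y) - f₁ 0) - (g y - s)| := by ring_nf
        _ ≤ |f₁ (C y) - f₁ 0| + |g y - s| := abs_sub _ _
        _ ≤ 2 * η := by linarith [hgη y]
  have hφbd : ∀ x, -(2 * l) ≤ φ x ∧ φ x ≤ -(l / 2) := fun x => by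
    obtain ⟨h1, h2⟩ := abs_le.1 (hφl x)
    exact ⟨by linarith, by linarith⟩
  refine ⟨ε, hε0, min_le_left _ _, g, φ, hgc, continuous_meanSlope hcl₁ hgc, hg0,
    fun x => (hφbd x).1, fun x => (hφbd x).2, fun x hx => ⟨?_, ?_, ?_, fun hx0 => ?_⟩⟩
  · rw [hφ, mul_meanSlope]
    refine intervalIntegral.integral_congr fun y hy => ?_
    have : |y| ≤ |x| := by
      have := abs_sub_left_of_mem_uIcc hy
      simpa using this
    simp only [hCx y (this.trans hx.le)]
  · exact hSpos x _ hx.le (hφbd x).1 (hφbd x).2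
  · obtain ⟨_, h1⟩ := abs_le.1 (hP x hx.le).2.2.1.le
    obtain ⟨h2, _⟩ := abs_le.1 (hgη x)
    linarith
  · refine (hg' x hx0 hx).congr_deriv ?_
    have hΦφ : Φ (φ x) = φ x := clamp_of_abs_le (by rw [sub_neg_eq_add]; exact hφl x)
    have hYg : Y (g x) = g x := clamp_of_abs_le (hgη x)
    simp only [he, hCx x hx.le, hΦφ, hYg, slowRemainder]
    rw [add_sub_cancel, div_div, mul_pow, mul_comm (φ x ^ 2)]

/-! ### Equilibrium strategies -/

/-- The equation for `g' = G` implies the differentiated Bellman equation for `p`. The left-hand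
side is `F p'`, with `p'` written as the quotient rule produces it. -/
theorem multiplier_deriv_identity {π δ ρ F f₀ f₁ f₂ y : ℝ} (hπ : π ≠ 0) (hF : F ≠ 0)
    (hS : f₀ - F ≠ 0) {G p : ℝ} (hG : G = slowNumerator π δ ρ F f₀ f₁ f₂ y / F ^ 2)
    (hp : p = (π + δ - f₁ + y * F / (f₀ - F)) / (π * (f₀ - F))) :
    ((-f₂ + ((G * F + y * (f₁ - y)) * (f₀ - F) - y * F * y) / (f₀ - F) ^ 2) * (π * (f₀ - F)) -
        (π + δ - f₁ + y * F / (f₀ - F)) * (π * y)) / (π * (f₀ - F)) ^ 2 * F =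
      ρ * p - y / (f₀ - F) - p * (f₁ - y) := by
  have hGF : G * F ^ 2 = slowNumerator π δ ρ F f₀ f₁ f₂ y := by rw [hG]; field_simp
  have hGF' : G * F * F = slowNumerator π δ ρ F f₀ f₁ f₂ y := by rw [← hGF]; ring
  subst hp
  rw [slowNumerator] at hGF'
  generalize f₀ - F = S at *
  field_simp
  field_simp at hGF'
  linear_combination hGF'

theorem exists_equilibrium {f : ℝ → ℝ} {π δ ρ : ℝ} (hπ : 0 < π) (hδ : 0 < δ) (hρ : 0 < ρ)
    (hf : ContDiffOn ℝ 2 f (Ioi 0)) {kbar : ℝ} (hk : kbar ∈ olgRange f π δ ρ)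
    (hpos : 0 < f kbar) :
    ∃ (Ω : Set ℝ) (σ : ℝ → ℝ), Ω ∈ 𝓝 kbar ∧
      IsEquilibriumStrategy f (olgDiscount π δ ρ) Real.log Ω σ ∧ ConvergesTo f Ω σ kbar := by
  obtain ⟨hk0, hd1, hd2⟩ := hk
  have hd1' : ρ * (π + δ) < deriv f kbar * (π + ρ) := by
    rwa [← mul_div_assoc, div_lt_iff₀ (by positivity)] at hd1
  have hργ : ρ < δ := by
    have : deriv f kbar * (π + ρ) < δ * (π + ρ) := by gcongr
    nlinarith
  have hγ : π + δ - ρ ≠ 0 := by linarith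
  have hδd := sub_pos.2 hd2
  set s := (deriv f kbar - ρ) * (π + δ - deriv f kbar) / (δ - deriv f kbar) with hs
  set l := s - deriv f kbar with hl
  have hs' : s * (δ - deriv f kbar) = (deriv f kbar - ρ) * (π + δ - deriv f kbar) := by
    rw [hs]; field_simp
  have hl0 : 0 < l := by
    have : 0 < l * (δ - deriv f kbar) := by
      rw [hl, sub_mul, hs']; linarith
    exact pos_of_mul_pos_left this hδd.le
  -- Regularity of `f`.
  have hf₁ : ContDiffOn ℝ 1 (deriv f) (Ioi 0) := hf.deriv_of_isOpen isOpen_Ioi (by norm_num)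
  have hc₀ : ContinuousOn f (Ioi 0) := hf.continuousOn
  have hc₁ : ContinuousOn (deriv f) (Ioi 0) := hf₁.continuousOn
  have hc₂ : ContinuousOn (deriv (deriv f)) (Ioi 0) :=
    hf₁.continuousOn_deriv_of_isOpen isOpen_Ioi le_rfl
  have hD₀ : ∀ k, 0 < k → HasDerivAt f (deriv f k) k := fun k hk =>
    ((hf.differentiableOn two_ne_zero).differentiableAt (Ioi_mem_nhds hk)).hasDerivAt
  have hD₁ : ∀ k, 0 < k → HasDerivAt (deriv f) (deriv (deriv f) k) k := fun k hk =>
    ((hf₁.differentiableOn one_ne_zero).differentiableAt (Ioi_mem_nhds hk)).hasDerivAt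
  have hmaps : MapsTo (fun x => kbar + x) (Icc (-(kbar / 2)) (kbar / 2)) (Ioi 0) := fun x hx => by
    have := hx.1
    simp only [mem_Ioi]; linarith
  have hshift : ContinuousOn (fun x => kbar + x) (Icc (-(kbar / 2)) (kbar / 2)) := by fun_prop
  obtain ⟨ε, hε, hεk, g, φ, hgc, hφc, hg0, hφlo, hφhi, hmain⟩ :=
    exists_slow_strategy (π := π) (δ := δ) (ρ := ρ) (f₀ := fun x => f (kbar + x))
      (f₁ := fun x => deriv f (kbar + x)) (f₂ := fun x => deriv (deriv f) (kbar + x))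
      (ε₀ := kbar / 2) (s := s) (l := l) (by positivity) (hc₀.comp hshift hmaps)
      (hc₁.comp hshift hmaps) (hc₂.comp hshift hmaps) (by simpa using hpos) (by simpa using hd2)
      hl0 (by simpa using hs') (by simp [hl])
  set Ω := Metric.ball kbar ε with hΩ
  have hΩabs : ∀ k ∈ Ω, |k - kbar| < ε := fun k hk => by rwa [← Real.dist_eq]
  have hΩpos : ∀ k ∈ Ω, 0 < k := fun k hk => by
    have := (abs_lt.1 (hΩabs k hk)).1
    linarith
  set σ : ℝ → ℝ := fun k => f kbar + ∫ y in (0 : ℝ)..(k - kbar), g y with hσ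
  have hσ' : ∀ k, HasDerivAt σ (g (k - kbar)) k := fun k => by
    have h := intervalIntegral.integral_hasDerivAt_right (hgc.intervalIntegrable 0 (k - kbar))
      (hgc.stronglyMeasurableAtFilter _ _) hgc.continuousAt
    have := (h.comp k ((hasDerivAt_id k).sub_const kbar)).const_add (f kbar)
    rw [mul_one] at this
    exact this
  have hσd : ∀ k, deriv σ k = g (k - kbar) := fun k => (hσ' k).deriv
  have hσC : ContDiff ℝ 1 σ := by
    rw [contDiff_one_iff_deriv]
    refine ⟨fun k => (hσ' k).differentiableAt, ?_⟩
    rw [funext hσd]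
    fun_prop
  -- Net investment vanishes at `kbar` and points towards it elsewhere.
  have hF : ∀ k ∈ Ω, f k - σ k = (k - kbar) * φ (k - kbar) := by
    intro k hk
    have hsub : ∀ y ∈ uIcc 0 (k - kbar), 0 < kbar + y := fun y hy => by
      have h1 := abs_sub_left_of_mem_uIcc hy
      have h2 := hΩabs k hk
      rw [sub_zero, sub_zero] at h1
      have := (abs_le.1 (h1.trans h2.le)).1
      linarith
    have hci : IntervalIntegrable (fun y => deriv f (kbar + y)) volume 0 (k - kbar) := by
      refine ContinuousOn.intervalIntegrable ?_
      exact hc₁.comp (by fun_prop) hsub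
    rw [(hmain _ (hΩabs k hk)).1, intervalIntegral.integral_sub hci (hgc.intervalIntegrable _ _),
      intervalIntegral.integral_eq_sub_of_hasDerivAt (f := fun y => f (kbar + y))
        (fun y hy => (hD₀ _ (hsub y hy)).comp_const_add kbar y) hci]
    simp only [hσ, add_sub_cancel, add_zero]
    ring
  have hσeq : ∀ k ∈ Ω, σ k = f k - (k - kbar) * φ (k - kbar) := fun k hk => by
    linarith [hF k hk]
  have hσpos : ∀ k ∈ Ω, 0 < σ k := fun k hk => by
    have := (hmain _ (hΩabs k hk)).2.1
    rw [hσeq k hk]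
    simpa using this
  have hc₀Ω : ContinuousOn f Ω := hc₀.mono hΩpos
  have hc₁Ω : ContinuousOn (deriv f) Ω := hc₁.mono hΩpos
  set p : ℝ → ℝ := fun k =>
    (π + δ - deriv f k + g (k - kbar) * (f k - σ k) / σ k) / (π * σ k) with hp
  have hpc : ContinuousOn p Ω := by
    have h1 : ContinuousOn σ Ω := hσC.continuous.continuousOn
    have h2 : ContinuousOn (fun k => g (k - kbar)) Ω := by fun_prop
    refine ContinuousOn.div (ContinuousOn.add (continuousOn_const.sub hc₁Ω)
      (ContinuousOn.div (h2.mul (hc₀Ω.sub h1)) h1 fun k hk => (hσpos k hk).ne'))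
      (continuousOn_const.mul h1) fun k hk => (mul_pos hπ (hσpos k hk)).ne'
  -- The capital paths, in terms of the distance to `kbar`.
  have hpath : ∀ k ∈ Ω, ∃ κ : ℝ → ℝ, κ 0 = k ∧ (∀ t, 0 ≤ t → |κ t - kbar| ≤ |k - kbar|) ∧
      (∀ t, 0 ≤ t → HasDerivAt κ (f (κ t) - σ (κ t)) t) ∧ Tendsto κ atTop (𝓝 kbar) ∧
      (k ≠ kbar → ∀ t, κ t ≠ kbar) ∧ (k = kbar → ∀ t, κ t = kbar) := by
    intro k hk
    obtain ⟨x, hx0, hx', hxle, hxne, hxz⟩ :=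
      exists_decaying_path hφc (half_pos hl0) hφlo hφhi (k - kbar)
    have hle : ∀ t, 0 ≤ t → |x t| ≤ |k - kbar| := fun t ht => by
      refine (hxle t ht).trans (mul_le_of_le_one_right (abs_nonneg _) ?_)
      rw [Real.exp_le_one_iff]
      nlinarith
    refine ⟨fun t => kbar + x t, by simp [hx0], fun t ht => by simpa using hle t ht,
      fun t ht => ?_, ?_, fun h t => ?_, fun h t => ?_⟩
    · have hmem : kbar + x t ∈ Ω := by
        rw [hΩ, Metric.mem_ball, Real.dist_eq, add_sub_cancel_left]
        exact (hle t ht).trans_lt (hΩabs k hk)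
      rw [hF _ hmem, add_sub_cancel_left]
      exact (hx' t).const_add kbar
    · have hexp : Tendsto (fun t => |k - kbar| * Real.exp (-(l / 2) * t)) atTop (𝓝 0) := by
        have := (Real.tendsto_exp_atBot.comp ((tendsto_const_mul_atBot_of_neg
          (by linarith : -(l / 2) < 0)).2 tendsto_id)).const_mul |k - kbar|
        simpa using this
      have hx : Tendsto x atTop (𝓝 0) := by
        refine squeeze_zero_norm' ?_ hexp
        filter_upwards [eventually_ge_atTop 0] with t ht
        exact hxle t ht
      simpa using hx.const_add kbar
    · simpa using hxne (sub_ne_zero.2 h) t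
    · simpa using hxz (sub_eq_zero.2 h) t
  have hopt : ∀ k ∈ Ω, IsOptimalAt f (olgDiscount π δ ρ) Real.log Ω σ k := by
    intro k hk
    obtain ⟨κ, hκ0, hκle, hκ', -, hκne, hκeq⟩ := hpath k hk
    have hKΩ : Metric.closedBall kbar |k - kbar| ⊆ Ω :=
      Metric.closedBall_subset_ball (hΩabs k hk)
    have hκK : ∀ t, 0 ≤ t → κ t ∈ Metric.closedBall kbar |k - kbar| := fun t ht => by
      rw [Metric.mem_closedBall, Real.dist_eq]; exact hκle t ht
    refine isOptimalAt_of_multiplier (by positivity) hρ hγ Metric.isOpen_ball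
      (isCompact_closedBall kbar |k - kbar|) hKΩ hc₁Ω hσC.contDiffOn hσpos
      (fun k hk => ?_) hpc (fun k hk => ?_) hκ0 hκK hκ' (fun t ht => ?_)
    · have := (hmain _ (hΩabs k hk)).2.2.1
      rw [hσd]
      simpa using this
    · have := (hσpos k hk).ne'
      simp only [hp, hσd]
      field_simp
    · by_cases hkk : k = kbar
      -- At the steady state the path is constant, and the equation is the one that determines `s`.
      · have hκc : κ = fun _ => kbar := funext (hκeq hkk)
        have hkb : kbar ∈ Ω := Metric.mem_ball_self hε
        have hσk : σ kbar = f kbar := by simp [hσ]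
        simp only [hκc]
        refine (hasDerivAt_const t (p kbar)).congr_deriv ?_
        simp only [hp, hσd, sub_self, hg0, hσk, mul_zero, zero_div, add_zero]
        field_simp
        linear_combination -hs'
      · have hκΩ := hKΩ (hκK t ht)
        set z := κ t with hz
        have hxne : z - kbar ≠ 0 := sub_ne_zero.2 (hκne hkk t)
        have hzS := (hσpos z hκΩ).ne'
        have hφ0 : φ (z - kbar) ≠ 0 := by linarith [hφhi (z - kbar)]
        have hFne : f z - σ z ≠ 0 := by
          rw [hF z hκΩ]; exact mul_ne_zero hxne hφ0
        have hg' := (hmain _ (hΩabs z hκΩ)).2.2.2 hxne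
        simp only [← hF z hκΩ, add_sub_cancel] at hg'
        have hg'' : HasDerivAt (fun k => g (k - kbar)) _ z := hg'.comp_sub_const z kbar
        have hzpos := hΩpos z hκΩ
        have hFd := (hD₀ z hzpos).fun_sub (hσ' z)
        have hpd : HasDerivAt p _ z :=
          (((hD₁ z hzpos).const_sub (π + δ)).fun_add
            ((hg''.fun_mul hFd).fun_div (hσ' z) hzS)).fun_div ((hσ' z).const_mul π)
            (mul_ne_zero hπ.ne' hzS)
        have hcomp := HasDerivAt.comp t hpd (hκ' t ht)
        refine hcomp.congr_deriv ?_
        have hfF : f z - (f z - σ z) = σ z := by ring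
        have hid := multiplier_deriv_identity (F := f z - σ z) (f₀ := f z) hπ.ne' hFne
          (by rwa [hfF]) rfl (p := p z) (by rw [hfF])
          (δ := δ) (ρ := ρ) (f₁ := deriv f z) (f₂ := deriv (deriv f) z) (y := g (z - kbar))
        rw [hfF] at hid
        rw [hσd]
        exact hid
  have hconv : ConvergesTo f Ω σ kbar := by
    filter_upwards [Metric.ball_mem_nhds kbar hε] with k hk
    obtain ⟨κ, hκ0, hκle, hκ', hκlim, -, -⟩ := hpath k hk
    refine ⟨κ, ⟨hκ0, fun t ht => ?_, fun t ht => (hκ' t ht).hasDerivWithinAt⟩, hκlim⟩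
    rw [hΩ, Metric.mem_ball, Real.dist_eq]
    exact (hκle t ht).trans_lt (hΩabs k hk)
  exact ⟨Ω, σ, Metric.ball_mem_nhds kbar hε, ⟨Metric.isOpen_ball, hΩpos, hσpos, hσC.contDiffOn,
    ⟨kbar, hconv⟩, hopt⟩, hconv⟩

theorem isOpen_olgRange {f : ℝ → ℝ} (hf : ContDiffOn ℝ 2 f (Ioi 0)) (π δ ρ : ℝ) :
    IsOpen (olgRange f π δ ρ) := by
  have hc : ContinuousOn (deriv f) (Ioi 0) :=
    hf.continuousOn_deriv_of_isOpen isOpen_Ioi one_le_two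
  exact hc.isOpen_inter_preimage isOpen_Ioi (isOpen_Ioo (a := ρ * ((π + δ) / (π + ρ))) (b := δ))

end GrowthGame


theorem theorem2 (f : ℝ → ℝ) (π δ ρ : ℝ) (hπ : 0 < π) (hδ : 0 < δ) (hρ : 0 < ρ)
    (hf : ContDiffOn ℝ 2 f (Ioi 0)) (hconc : ConcaveOn ℝ (Ioi 0) f)
    (hpos : ∀ k ∈ GrowthGame.olgRange f π δ ρ, 0 < f k) :
    (∀ kbar ∈ GrowthGame.olgRange f π δ ρ, ∃ (Ω : Set ℝ) (σ : ℝ → ℝ), Ω ∈ 𝓝 kbar ∧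
      GrowthGame.IsEquilibriumStrategy f (GrowthGame.olgDiscount π δ ρ) Real.log Ω σ ∧
      GrowthGame.ConvergesTo f Ω σ kbar) ∧
    ((GrowthGame.olgRange f π δ ρ).Nonempty →
      (∃ a b : ℝ, a < b ∧ Ioo a b ⊆ GrowthGame.olgSteadyStates f π δ ρ) ∧
      Cardinal.mk (GrowthGame.olgSteadyStates f π δ ρ) = Cardinal.continuum) := by
  have main : ∀ kbar ∈ GrowthGame.olgRange f π δ ρ, ∃ (Ω : Set ℝ) (σ : ℝ → ℝ), Ω ∈ 𝓝 kbar ∧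
      GrowthGame.IsEquilibriumStrategy f (GrowthGame.olgDiscount π δ ρ) Real.log Ω σ ∧
      GrowthGame.ConvergesTo f Ω σ kbar := fun kbar hk =>
    GrowthGame.exists_equilibrium hπ hδ hρ hf hk (hpos kbar hk)
  refine ⟨main, fun ⟨k, hk⟩ => ?_⟩
  obtain ⟨a, b, hkab, hab⟩ := mem_nhds_iff_exists_Ioo_subset.1
    ((GrowthGame.isOpen_olgRange hf π δ ρ).mem_nhds hk)
  have hlt : a < b := hkab.1.trans hkab.2
  have hsub : Ioo a b ⊆ GrowthGame.olgSteadyStates f π δ ρ := fun x hx => main x (hab hx)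
  refine ⟨⟨a, b, hlt, hsub⟩, le_antisymm ?_ ?_⟩
  · exact (Cardinal.mk_set_le _).trans_eq Cardinal.mk_real
  · exact (Cardinal.mk_Ioo_real hlt).symm.trans_le (Cardinal.mk_le_mk_of_subset hsub)
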